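/- **Theorem 4.2.** Let $n\ge 1$, let $\mathbb F_n^+$ be the free semigroup on generators $g_1,\dots,g_n$ with neutral element $g_0$, and let $\mu=\{\mu_\beta\}_{\beta\in\mathbb F_n^+}$ be strictly positive real numbers with $\mu_{g_0}=1$ and $\sup\{\mu_{g_i\alpha}:\alpha\in\mathbb F_n^+,\ 1\le i\le n\}<\infty$. For $\alpha=g_{i_1}\cdots g_{i_k}$ put $\mu(\alpha,g_0)=\mu_{g_{i_1}\cdots g_{i_k}}\mu_{g_{i_2}\cdots g_{i_k}}\cdots\mu_{g_{i_k}}$, $\mu(g_0,g_0)=1$, and $|\alpha|=k$; for an $n$-tuple $X=(X_1,\dots,X_n)$ of complex numbers or of operators put $X_\alpha=X_{i_1}\cdots X_{i_k}$, with $X_{g_0}$ the identity. Let $F^2(\mu)$ be the Hilbert space of formal power series $f=\sum_\alpha c_\alpha Z_\alpha$ ($c_\alpha\in\mathbb C$) in noncommuting indeterminates $Z_1,\dots,Z_n$ with $\|f\|_\mu^2=\sum_\alpha\mu(\alpha,g_0)^2|c_\alpha|^2<\infty$, let $L_{Z_i}f=Z_if$ on $F^2(\mu)$ and $L_Z=(L_{Z_1},\dots,L_{Z_n})$.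 For a tuple $X$ of bounded operators on a Hilbert space write $\|X\|=\|X_1X_1^*+\dots+X_nX_n^*\|^{1/2}$. Let $\mathcal D(\mu)$ be the set of bounded point evaluations, i.e. of those $\lambda\in\mathbb C^n$ for which there is $C>0$ with $|p(\lambda)|\le C\|p\|_\mu$ for all $p\in\mathbb C\langle Z_1,\dots,Z_n\rangle$; then $\varphi_\lambda$ denotes the bounded linear functional on $F^2(\mu)$ that extends $p\mapsto p(\lambda)$. The joint point spectrum $\sigma_p(T_1,\dots,T_n)$ is the set of $\zeta\in\mathbb C^n$ for which there is $z\ne0$ with $T_iz=\zeta_iz$ for all $i$. 1. $$\mathcal D(\mu)=\Big\{\lambda\in\mathbb C^n:\ \sum_{\alpha\in\mathbb F_n^+}\frac{|\lambda_\alpha|^2}{\mu(\alpha,g_0)^2}<\infty\Big\}=\sigma_p(L_{Z_1}^*,\dots,L_{Z_n}^*).$$ 2. If $\lambda\in\mathcal D(\mu)$, then the bounded extension $\varphi_\lambda$ exists and is unique, and for every $f=\sum_\alpha c_\alpha Z_\alpha\in F^2(\mu)$ the series $f(\lambda):=\sum_\alpha c_\alpha\lambda_\alpha$ converges absolutely to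 $\varphi_\lambda(f)$, with $$|f(\lambda)|\le\|f\|_\mu\Big(\sum_{\alpha}\frac{|\lambda_\alpha|^2}{\mu(\alpha,g_0)^2}\Big)^{1/2}.$$ 3. If $\lambda\in\mathbb C^n$ and $\sum_{k=0}^\infty\sum_{|\alpha|=k}c_\alpha\lambda_\alpha$ converges for every $f=\sum_\alpha c_\alpha Z_\alpha\in F^2(\mu)$, then $\lambda\in\mathcal D(\mu)$. 4. Let $\mathcal H$ be an infinite-dimensional complex Hilbert space and let $\varphi=\sum_\alpha c_\alpha Z_\alpha$ be a bounded free holomorphic function on the open ball $\{X\in B(\mathcal H)^n:\|X\|<\|L_Z\|\}$, i.e. $\varphi(X)=\sum_{k=0}^\infty\sum_{|\alpha|=k}c_\alpha X_\alpha$ converges in norm for every $X$ in the ball and $\|\varphi(X)\|$ is bounded there. Then $\varphi$ is a left multiplier of $F^2(\mu)$, i.e. the product of formal power series $\varphi\zeta$ is in $F^2(\mu)$ for every $\zeta\in F^2(\mu)$; the operator $L_\varphi\zeta=\varphi\zeta$ is bounded; there is a unique bounded operator $\varphi(L_{Z_1},\dots,L_{Z_n})$ on $F^2(\mu)$ that sends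 every polynomial $p$ to $\sum_\alpha c_\alpha (L_Z)_\alpha p$ (a convergent series in $F^2(\mu)$); and $$\|L_\varphi\|=\|\varphi(L_{Z_1},\dots,L_{Z_n})\|\le\sup\{\|\varphi(X_1,\dots,X_n)\|:\ X\in B(\mathcal H)^n,\ \|X\|<\|L_Z\|\}.$$ -/

import Mathlib

open Filter Topology

namespace WeightedFock

/-- The free semigroup on the `n` generators `g_1, …, g_n`, with neutral element `g_0 = 1`. -/
abbrev Word (n : ℕ) : Type := FreeMonoid (Fin n)

instance (n : ℕ) : DecidableEq (Word n) := inferInstanceAs (DecidableEq (List (Fin n)))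

/-- Formal power series `∑ c_α Z_α` in `n` noncommuting indeterminates, given by coefficients. -/
abbrev Series (n : ℕ) : Type := Word n → ℂ

/-- Noncommutative polynomials `ℂ⟨Z_1, …, Z_n⟩`. -/
abbrev NCPoly (n : ℕ) : Type := MonoidAlgebra ℂ (Word n)

/-- The finite set of words of length `k`. -/
def words (n k : ℕ) : Finset (Word n) :=
  Finset.univ.image fun v : Fin k → Fin n => FreeMonoid.ofList (List.ofFn v)

theorem mem_words {n k : ℕ} {α : Word n} : α ∈ words n k ↔ α.length = k := by
  simp only [words, Finset.mem_image, Finset.mem_univ, true_and]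
  constructor
  · rintro ⟨v, rfl⟩
    exact List.length_ofFn
  · rintro rfl
    exact ⟨fun i => α.toList.get i, List.ofFn_get α.toList⟩

/-- The partial sums `∑_{k < N} ∑_{|α| = k} c_α x_α` of a series grouped by word length. -/
noncomputable def partialSum {n : ℕ} {E : Type*} [AddCommGroup E] [Module ℂ E]
    (c : Series n) (x : Word n → E) (N : ℕ) : E :=
  ∑ k ∈ Finset.range N, ∑ α ∈ words n k, c α • x α

/-- The finite set of factorizations `γ = α β` of a word. -/
def splits {n : ℕ} (γ : Word n) : Finset (Word n × Word n) :=
  (Finset.range (γ.length + 1)).image fun k =>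
    (FreeMonoid.ofList (γ.toList.take k), FreeMonoid.ofList (γ.toList.drop k))

theorem mem_splits {n : ℕ} {γ : Word n} {p : Word n × Word n} :
    p ∈ splits γ ↔ p.1 * p.2 = γ := by
  simp only [splits, Finset.mem_image, Finset.mem_range]
  constructor
  · rintro ⟨k, -, rfl⟩
    exact List.take_append_drop k γ.toList
  · rintro rfl
    refine ⟨p.1.length, ?_, ?_⟩
    · rw [FreeMonoid.length_mul]; omega
    · exact Prod.ext (List.take_left (l₁ := p.1.toList) (l₂ := p.2.toList))
        (List.drop_left (l₁ := p.1.toList) (l₂ := p.2.toList))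

/-- The product of formal power series: the coefficient of `Z_γ` is `∑_{αβ = γ} a_α d_β`. -/
noncomputable def mulSeries {n : ℕ} (a d : Series n) : Series n :=
  fun γ => ∑ p ∈ splits γ, a p.1 * d p.2

/-- The monomial `Z_α` as a formal power series. -/
def monomial {n : ℕ} (α : Word n) : Series n := Pi.single α 1

theorem mulSeries_gen_one {n : ℕ} (i : Fin n) (d : Series n) :
    mulSeries (monomial (FreeMonoid.of i)) d 1 = 0 := by
  refine Finset.sum_eq_zero fun p hp => ?_
  have h := mem_splits.1 hp
  have h1 : p.1 ≠ FreeMonoid.of i := by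
    intro h2
    have := congrArg FreeMonoid.length h
    rw [FreeMonoid.length_mul, h2, FreeMonoid.length_of, FreeMonoid.length_one] at this
    omega
  simp [monomial, h1]

theorem mulSeries_gen_of_mul {n : ℕ} (i j : Fin n) (d : Series n) (γ : Word n) :
    mulSeries (monomial (FreeMonoid.of i)) d (FreeMonoid.of j * γ) = if j = i then d γ else 0 := by
  have key : ∀ p ∈ splits (FreeMonoid.of j * γ), p.1 = FreeMonoid.of i → j = i ∧ p.2 = γ := by
    intro p hp h
    have h2 := mem_splits.1 hp
    rw [h] at h2
    have h3 : i :: p.2.toList = j :: γ.toList := h2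
    injection h3 with h4 h5
    exact ⟨h4.symm, h5⟩
  unfold mulSeries
  split_ifs with hji
  · subst hji
    rw [Finset.sum_eq_single (FreeMonoid.of j, γ)]
    · simp [monomial]
    · intro p hp hne
      have : p.1 ≠ FreeMonoid.of j := fun h => hne (Prod.ext h (key p hp h).2)
      simp [monomial, this]
    · intro h
      exact absurd ((mem_splits (p := (FreeMonoid.of j, γ))).2 rfl) h
  · refine Finset.sum_eq_zero fun p hp => ?_
    have : p.1 ≠ FreeMonoid.of i := fun h => hji (key p hp h).1
    simp [monomial, this]

/-- A sequence of strictly positive weights `μ_β` with `μ_{g_0} = 1` and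
`sup_{α, i} μ_{g_i α} < ∞`. -/
structure Weights (n : ℕ) where
  μ : Word n → ℝ
  pos : ∀ β, 0 < μ β
  one : μ 1 = 1
  bdd : BddAbove (Set.range fun p : Fin n × Word n => μ (FreeMonoid.of p.1 * p.2))

variable {n : ℕ} (w : Weights n)

/-- `μ_{g_{i_1} ⋯ g_{i_k}} μ_{g_{i_2} ⋯ g_{i_k}} ⋯ μ_{g_{i_k}}` for the list `i_1, …, i_k`. -/
def Weights.listNorm : List (Fin n) → ℝ
  | [] => 1
  | i :: l => w.μ (FreeMonoid.ofList (i :: l)) * Weights.listNorm l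

/-- The number `μ(α, g_0)`, which is the norm of `Z_α`. -/
def Weights.mon (α : Word n) : ℝ := w.listNorm α.toList

theorem Weights.mon_one : w.mon 1 = 1 := rfl

theorem Weights.mon_of_mul (i : Fin n) (α : Word n) :
    w.mon (FreeMonoid.of i * α) = w.μ (FreeMonoid.of i * α) * w.mon α := rfl

theorem Weights.mon_pos (α : Word n) : 0 < w.mon α := by
  induction α using FreeMonoid.inductionOn' with
  | one => rw [w.mon_one]; exact one_pos
  | of_mul i α ih => rw [w.mon_of_mul]; exact mul_pos (w.pos _) ih

theorem memlp_iff (c : Series n) :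
    Memℓp (fun α => (w.mon α : ℂ) * c α) 2 ↔ Summable fun α => w.mon α ^ 2 * ‖c α‖ ^ 2 := by
  rw [memℓp_gen_iff (by norm_num)]
  refine summable_congr fun α => ?_
  simp [mul_pow]

/-- The formal power series `∑ c_α Z_α` with `∑ μ(α, g_0)² |c_α|² < ∞`. -/
def hardySubmodule : Submodule ℂ (Series n) where
  carrier := {c | Summable fun α => w.mon α ^ 2 * ‖c α‖ ^ 2}
  add_mem' {a b} ha hb := by
    have h := ((memlp_iff w a).2 ha).add ((memlp_iff w b).2 hb)
    refine (memlp_iff w (a + b)).1 ?_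
    convert h using 1
    ext α
    simp [mul_add]
  zero_mem' := by simp [summable_zero]
  smul_mem' r a ha := by
    have h := ((memlp_iff w a).2 ha).const_smul r
    refine (memlp_iff w (r • a)).1 ?_
    convert h using 1
    ext α
    simp [mul_left_comm]

theorem mem_hardySubmodule (c : Series n) :
    c ∈ hardySubmodule w ↔ Summable fun α => w.mon α ^ 2 * ‖c α‖ ^ 2 := Iff.rfl

/-- The Hilbert space `F²(μ)`. -/
def F2 : Type := hardySubmodule w

noncomputable section

instance : AddCommGroup (F2 w) := inferInstanceAs (AddCommGroup (hardySubmodule w))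
instance : Module ℂ (F2 w) := inferInstanceAs (Module ℂ (hardySubmodule w))

variable {w}

/-- The formal power series underlying an element of `F²(μ)`; `f.series α` is its coefficient
at `Z_α`. -/
def F2.series (f : F2 w) : Series n := Subtype.val (p := fun c => c ∈ hardySubmodule w) f

theorem F2.summable (f : F2 w) : Summable fun α => w.mon α ^ 2 * ‖f.series α‖ ^ 2 :=
  Subtype.property (p := fun c => c ∈ hardySubmodule w) f

/-- The element of `F²(μ)` given by a formal power series in `F²(μ)`. -/
def F2.mk (c : Series n) (hc : c ∈ hardySubmodule w) : F2 w := ⟨c, hc⟩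

@[simp] theorem F2.series_mk (c : Series n) (hc : c ∈ hardySubmodule w) :
    (F2.mk c hc).series = c := rfl

@[ext] theorem F2.ext {f g : F2 w} (h : f.series = g.series) : f = g := Subtype.ext h

@[simp] theorem F2.series_add (f g : F2 w) : (f + g).series = f.series + g.series := rfl
@[simp] theorem F2.series_smul (r : ℂ) (f : F2 w) : (r • f).series = r • f.series := rfl
@[simp] theorem F2.series_zero : (0 : F2 w).series = 0 := rfl

variable (w)

/-- The linear bijection `f ↦ (μ(α, g_0) c_α)_α` from `F²(μ)` onto `ℓ²`. -/
def toL2 : F2 w ≃ₗ[ℂ] lp (fun _ : Word n => ℂ) 2 where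
  toFun f := ⟨fun α => (w.mon α : ℂ) * f.series α, (memlp_iff w _).2 f.summable⟩
  map_add' f g := by
    ext α
    exact mul_add _ _ _
  map_smul' r f := by
    ext α
    exact mul_left_comm _ _ _
  invFun x := F2.mk (fun α => (w.mon α : ℂ)⁻¹ * x α) <| (mem_hardySubmodule w _).2 <| (memlp_iff w _).1 <| by
    convert lp.memℓp x using 1
    ext α
    have : (w.mon α : ℂ) ≠ 0 := by exact_mod_cast (w.mon_pos α).ne'
    field_simp
  left_inv f := by
    ext α
    have : (w.mon α : ℂ) ≠ 0 := by exact_mod_cast (w.mon_pos α).ne'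
    simp [this]
  right_inv x := by
    ext α
    have : (w.mon α : ℂ) ≠ 0 := by exact_mod_cast (w.mon_pos α).ne'
    simp [this]

theorem toL2_apply (f : F2 w) (α : Word n) : toL2 w f α = (w.mon α : ℂ) * f.series α := rfl

theorem inner_toL2 (f g : F2 w) : inner ℂ (toL2 w f) (toL2 w g) =
    ∑' α, (w.mon α : ℂ) ^ 2 * (starRingEnd ℂ (f.series α) * g.series α) := by
  rw [lp.inner_eq_tsum]
  refine tsum_congr fun α => ?_
  simp only [toL2_apply, RCLike.inner_apply, map_mul, Complex.conj_ofReal]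
  ring

/-- The inner product `⟨f, g⟩ = ∑ μ(α, g_0)² conj(f_α) g_α` of `F²(μ)` (conjugate linear in the
first variable, as everywhere in Mathlib). -/
@[reducible] def F2.core : InnerProductSpace.Core ℂ (F2 w) where
  inner f g := ∑' α, (w.mon α : ℂ) ^ 2 * (starRingEnd ℂ (f.series α) * g.series α)
  conj_inner_symm f g := by simp only [← inner_toL2]; exact inner_conj_symm _ _
  re_inner_nonneg f := by simp only [← inner_toL2]; exact inner_self_nonneg
  add_left f g h := by simp only [← inner_toL2, map_add]; exact inner_add_left _ _ _
  smul_left f g r := by simp only [← inner_toL2, map_smul]; exact inner_smul_left _ _ _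
  definite f hf := by
    simp only [← inner_toL2] at hf
    exact (toL2 w).map_eq_zero_iff.1 (inner_self_eq_zero.1 hf)

instance : NormedAddCommGroup (F2 w) := (F2.core w).toNormedAddCommGroup
instance : InnerProductSpace ℂ (F2 w) := InnerProductSpace.ofCore (F2.core w).toCore

theorem F2.inner_def (f g : F2 w) : inner ℂ f g =
    ∑' α, (w.mon α : ℂ) ^ 2 * (starRingEnd ℂ (f.series α) * g.series α) := rfl

theorem norm_toL2 (f : F2 w) : ‖toL2 w f‖ = ‖f‖ := by
  rw [@norm_eq_sqrt_re_inner ℂ, @norm_eq_sqrt_re_inner ℂ _ _ _ _ f, inner_toL2, F2.inner_def]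

theorem F2.norm_sq (f : F2 w) : ‖f‖ ^ 2 = ∑' α, w.mon α ^ 2 * ‖f.series α‖ ^ 2 := by
  have h := lp.norm_rpow_eq_tsum (p := 2) (by norm_num) (toL2 w f)
  rw [norm_toL2] at h
  simpa [toL2_apply, mul_pow] using h

/-- The map `toL2` as a unitary operator. -/
def toL2Isometry : F2 w ≃ₗᵢ[ℂ] lp (fun _ : Word n => ℂ) 2 := ⟨toL2 w, norm_toL2 w⟩

instance : CompleteSpace (F2 w) :=
  (toL2Isometry w).isometry.isUniformInducing.completeSpace_congr
    (toL2Isometry w).surjective |>.2 inferInstance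

/-- Noncommutative polynomials as elements of `F²(μ)`. -/
def ofPoly (p : NCPoly n) : F2 w :=
  F2.mk (fun α => p.coeff α) <| (mem_hardySubmodule w _).2 <| summable_of_ne_finset_zero (s := p.coeff.support) <| by
    intro α hα
    simp [Finsupp.notMem_support_iff.1 hα]

theorem hasSum_shift (i : Fin n) (f : F2 w) :
    HasSum (fun γ => w.mon γ ^ 2 * ‖mulSeries (monomial (FreeMonoid.of i)) f.series γ‖ ^ 2)
      (∑' α, w.mon (FreeMonoid.of i * α) ^ 2 * ‖f.series α‖ ^ 2) := by
  obtain ⟨C, hC⟩ := w.bdd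
  have hs : Summable fun α => w.mon (FreeMonoid.of i * α) ^ 2 * ‖f.series α‖ ^ 2 := by
    refine Summable.of_nonneg_of_le (fun α => by positivity) (fun α => ?_)
      (f.summable.mul_left (C ^ 2))
    rw [w.mon_of_mul, mul_pow, mul_assoc]
    have h1 : w.μ (FreeMonoid.of i * α) ≤ C := hC ⟨(i, α), rfl⟩
    have h2 := (w.pos (FreeMonoid.of i * α)).le
    gcongr
  have hinj : Function.Injective fun α : Word n => FreeMonoid.of i * α := fun α β h =>
    mul_left_cancel h
  refine (hinj.hasSum_iff ?_).1 ?_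
  · intro γ hγ
    induction γ using FreeMonoid.casesOn with
    | one => simp [mulSeries_gen_one]
    | of_mul j γ =>
      have : j ≠ i := by
        rintro rfl
        exact hγ ⟨γ, rfl⟩
      simp [mulSeries_gen_of_mul, this]
  · convert hs.hasSum using 2 with α
    simp [mulSeries_gen_of_mul]

/-- The left multiplication operator `L_{Z_i} ζ = Z_i ζ` on `F²(μ)`. -/
def LZ (i : Fin n) : F2 w →L[ℂ] F2 w :=
  LinearMap.mkContinuousOfExistsBound
    { toFun := fun f => F2.mk (mulSeries (monomial (FreeMonoid.of i)) f.series)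
        ((mem_hardySubmodule w _).2 (hasSum_shift w i f).summable)
      map_add' := fun f g => by
        ext γ; simp [mulSeries, mul_add, Finset.sum_add_distrib]
      map_smul' := fun r f => by
        ext γ; simp [mulSeries, Finset.mul_sum, mul_left_comm] } <| by
    obtain ⟨C, hC⟩ := w.bdd
    have hC0 : 0 ≤ C := (w.pos _).le.trans (hC ⟨(i, 1), rfl⟩)
    refine ⟨C, fun f => ?_⟩
    refine le_of_sq_le_sq ?_ (by positivity)
    rw [mul_pow, F2.norm_sq, F2.norm_sq, ← tsum_mul_left]
    refine ((hasSum_shift w i f).tsum_eq).trans_le ?_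
    have hle : ∀ α, w.mon (FreeMonoid.of i * α) ^ 2 * ‖f.series α‖ ^ 2 ≤
        C ^ 2 * (w.mon α ^ 2 * ‖f.series α‖ ^ 2) := by
      intro α
      rw [w.mon_of_mul, mul_pow, mul_assoc]
      have h1 : w.μ (FreeMonoid.of i * α) ≤ C := hC ⟨(i, α), rfl⟩
      have h2 := (w.pos (FreeMonoid.of i * α)).le
      gcongr
    exact (Summable.of_nonneg_of_le (fun α => by positivity) hle
      (f.summable.mul_left (C ^ 2))).tsum_le_tsum hle (f.summable.mul_left (C ^ 2))

theorem LZ_series (i : Fin n) (f : F2 w) :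
    (LZ w i f).series = mulSeries (monomial (FreeMonoid.of i)) f.series := rfl

/-- The evaluation `φ_λ(p) = p(λ)` of polynomials at a point of `ℂⁿ`. Here `FreeMonoid.lift z` is
the map `α ↦ λ_α = λ_{i_1} ⋯ λ_{i_k}` for `α = g_{i_1} ⋯ g_{i_k}`. -/
def evalPoly (z : Fin n → ℂ) (p : NCPoly n) : ℂ :=
  MonoidAlgebra.lift ℂ ℂ (Word n) (FreeMonoid.lift z) p

/-- The set `𝓓(μ)` of bounded point evaluations on `F²(μ)`. -/
def boundedPointEvals : Set (Fin n → ℂ) :=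
  {z | ∃ C : ℝ, 0 < C ∧ ∀ p : NCPoly n, ‖evalPoly z p‖ ≤ C * ‖ofPoly w p‖}

/-- A bounded linear functional on `F²(μ)` that extends `φ_λ`. -/
def ExtendsEval (z : Fin n → ℂ) (ℓ : F2 w →L[ℂ] ℂ) : Prop :=
  ∀ p : NCPoly n, ℓ (ofPoly w p) = evalPoly z p

/-- The joint point spectrum of a tuple of operators: the set of tuples of joint eigenvalues. -/
def jointPointSpectrum {H : Type*} [NormedAddCommGroup H] [InnerProductSpace ℂ H]
    (T : Fin n → H →L[ℂ] H) : Set (Fin n → ℂ) :=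
  {z | ∃ x : H, x ≠ 0 ∧ ∀ i, T i x = z i • x}

/-- The norm `‖(X_1, …, X_n)‖ = ‖X_1 X_1^* + ⋯ + X_n X_n^*‖^{1/2}` of a row of operators. -/
def rowNorm {H : Type*} [NormedAddCommGroup H] [InnerProductSpace ℂ H] [CompleteSpace H]
    (X : Fin n → H →L[ℂ] H) : ℝ :=
  √‖∑ i, X i * ContinuousLinearMap.adjoint (X i)‖

/-- The open ball of radius `r` in `B(H)ⁿ`. -/
def opBall (n : ℕ) (H : Type*) [NormedAddCommGroup H] [InnerProductSpace ℂ H] [CompleteSpace H]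
    (r : ℝ) : Set (Fin n → H →L[ℂ] H) :=
  {X | rowNorm X < r}

/-- The formal power series `φ` is a free holomorphic function on the open ball of radius `r` of
`B(H)ⁿ`: the series `∑_k ∑_{|α| = k} c_α X_α` converges in norm at every point of the ball. -/
def IsFreeHolomorphic (H : Type*) [NormedAddCommGroup H] [InnerProductSpace ℂ H] [CompleteSpace H]
    (r : ℝ) (φ : Series n) : Prop :=
  ∀ X ∈ opBall n H r, ∃ Y : H →L[ℂ] H,
    Tendsto (partialSum φ fun α => FreeMonoid.lift X α) atTop (𝓝 Y)

/-- The value `φ(X) = ∑_k ∑_{|α| = k} c_α X_α` of a free holomorphic function. -/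
def evalOp {H : Type*} [NormedAddCommGroup H] [InnerProductSpace ℂ H]
    (φ : Series n) (X : Fin n → H →L[ℂ] H) : H →L[ℂ] H :=
  limUnder atTop (partialSum φ fun α => FreeMonoid.lift X α)

/-- `φ` is a bounded free holomorphic function on the open ball of radius `r` of `B(H)ⁿ`. -/
def IsBoundedFreeHolomorphic (H : Type*) [NormedAddCommGroup H] [InnerProductSpace ℂ H]
    [CompleteSpace H] (r : ℝ) (φ : Series n) : Prop :=
  IsFreeHolomorphic H r φ ∧ ∃ M : ℝ, ∀ X ∈ opBall n H r, ‖evalOp φ X‖ ≤ M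

/-- `φ` is a left multiplier of `F²(μ)`: the product `φ ζ` is in `F²(μ)` for all `ζ` in `F²(μ)`. -/
def IsLeftMultiplier (φ : Series n) : Prop :=
  ∀ ζ : F2 w, mulSeries φ ζ.series ∈ hardySubmodule w

/-- `A` is the operator `φ(L_{Z_1}, …, L_{Z_n})`: the bounded operator on `F²(μ)` that extends
`p ↦ ∑ c_α (L_Z)_α p`, with `p` ranging over the polynomials. -/
def IsSeriesOfShift (φ : Series n) (A : F2 w →L[ℂ] F2 w) : Prop :=
  ∀ p : NCPoly n, HasSum (fun α => φ α • (FreeMonoid.lift (LZ w) α) (ofPoly w p)) (A (ofPoly w p))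

end

end WeightedFock

open WeightedFock

/-! The monomials `Z_α` form an orthogonal basis of `F²(μ)` with `‖Z_α‖ = μ(α, g_0)`. By Parseval
and Riesz, the prescribed values `x_α` are attained by a bounded functional on the `Z_α`, or as
inner products `⟨Z_α, y⟩`, exactly when `∑ |x_α|² / μ(α, g_0)² < ∞`. For `x_α = λ_α` the
functional is the bounded point evaluation, and `y` is a joint eigenvector of the `L_{Z_i}^*`,
since `⟨Z_α, L_{Z_i}^* y⟩ = ⟨Z_{g_i α}, y⟩`. Part 3 is the Banach–Steinhaus theorem for the
partial sums.

For part 4, embed `F²(μ)` isometrically in `H`. Conjugation by the embedding carries `r L_Z`, for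
`0 < r < 1`, to a point of the open ball of `B(H)ⁿ`, and compression turns the value of `φ` there
into the operator `φ(r L_Z)`. This is the left multiplication by `φ_r(Z) = φ(r Z)`, with norm at
most `sup ‖φ(X)‖`. As `r → 1` the coefficients of `φ_r ζ` tend to those of `φ ζ`, and Fatou's lemma
gives `‖φ ζ‖ ≤ sup ‖φ(X)‖ ‖ζ‖`.
-/

namespace WeightedFock

noncomputable section

section PartialSums

variable {n : ℕ} {E : Type*} [AddCommGroup E] [Module ℂ E]

theorem partialSum_eq_sum {c : Series n} {x : Word n → E} {N : ℕ} {s : Finset (Word n)}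
    (hs : ∀ α ∈ s, α.length < N) (hc : ∀ α ∉ s, c α • x α = 0) :
    partialSum c x N = ∑ α ∈ s, c α • x α := by
  have hdisj : (Finset.range N : Set ℕ).PairwiseDisjoint (words n) := fun k _ l _ hkl =>
    Finset.disjoint_left.2 fun α hk hl => hkl ((mem_words.1 hk).symm.trans (mem_words.1 hl))
  rw [partialSum, ← Finset.sum_biUnion hdisj]
  refine (Finset.sum_subset (fun α hα => ?_) fun α _ => hc α).symm
  exact Finset.mem_biUnion.2 ⟨α.length, Finset.mem_range.2 (hs α hα), mem_words.2 rfl⟩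

theorem map_partialSum {E' F : Type*} [AddCommGroup E'] [Module ℂ E'] [FunLike F E E']
    [LinearMapClass F ℂ E E'] (g : F) (c : Series n) (x : Word n → E) (N : ℕ) :
    g (partialSum c x N) = partialSum c (fun α => g (x α)) N := by
  simp only [partialSum, map_sum, map_smul]

theorem lift_smul {ι R A : Type*} [CommSemiring R] [Semiring A] [Algebra R A] (r : R) (X : ι → A)
    (α : FreeMonoid ι) :
    FreeMonoid.lift (r • X) α = r ^ α.length • FreeMonoid.lift X α := by
  induction α using FreeMonoid.inductionOn' with
  | one => simp
  | of_mul i α ih => simp [ih, pow_add, smul_smul, mul_comm]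

/-- The dilation `φ_r(Z) = φ(r Z)` of a formal power series. -/
def dilate (r : ℂ) (φ : Series n) : Series n := fun α => r ^ α.length * φ α

theorem partialSum_lift_smul {A : Type*} [Ring A] [Algebra ℂ A] (φ : Series n) (r : ℂ)
    (X : Fin n → A) :
    (partialSum φ fun α => FreeMonoid.lift (r • X) α) =
      partialSum (dilate r φ) fun α => FreeMonoid.lift X α := by
  ext N
  simp only [partialSum, lift_smul, dilate, smul_smul, mul_comm]

theorem tendsto_dilate (φ : Series n) : Tendsto (dilate · φ) (𝓝 1) (𝓝 φ) := by
  have hcont : Continuous (dilate · φ) := by unfold dilate; fun_prop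
  have h1 : dilate 1 φ = φ := by ext α; simp [dilate]
  simpa only [h1] using hcont.tendsto 1

end PartialSums

section MulSeries

variable {n : ℕ}

theorem mulSeries_add (φ a b : Series n) :
    mulSeries φ (a + b) = mulSeries φ a + mulSeries φ b := by
  ext γ
  simp [mulSeries, mul_add, Finset.sum_add_distrib]

theorem mulSeries_smul (φ : Series n) (r : ℂ) (a : Series n) :
    mulSeries φ (r • a) = r • mulSeries φ a := by
  ext γ
  simp [mulSeries, Finset.mul_sum, mul_left_comm]

theorem continuous_mulSeries_left (d : Series n) : Continuous (mulSeries · d) := by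
  unfold mulSeries
  fun_prop

theorem mulSeries_monomial_mul (φ : Series n) (α β : Word n) :
    mulSeries φ (monomial β) (α * β) = φ α := by
  rw [mulSeries, Finset.sum_eq_single_of_mem (α, β) (mem_splits.2 rfl)]
  · simp [monomial]
  · intro p hp hne
    have hβ : p.2 ≠ β := by
      rintro rfl
      exact hne (Prod.ext (mul_right_cancel (mem_splits.1 hp)) rfl)
    simp [monomial, hβ]

theorem mulSeries_monomial_of_notMem_range (φ : Series n) {β γ : Word n}
    (h : γ ∉ Set.range (· * β)) : mulSeries φ (monomial β) γ = 0 := by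
  refine Finset.sum_eq_zero fun p hp => ?_
  have hβ : p.2 ≠ β := fun hβ => h ⟨p.1, hβ ▸ mem_splits.1 hp⟩
  simp [monomial, hβ]

end MulSeries

section Isometry

variable {𝕜 E H : Type*} [RCLike 𝕜] [NormedAddCommGroup E] [InnerProductSpace 𝕜 E]
  [NormedAddCommGroup H] [InnerProductSpace 𝕜 H] [CompleteSpace H]

theorem exists_linearIsometry_of_countable {ι : Type*} [Countable ι] (b : HilbertBasis ι 𝕜 E)
    (hH : ¬ FiniteDimensional 𝕜 H) : Nonempty (E →ₗᵢ[𝕜] H) := by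
  obtain ⟨s, e, -⟩ := exists_hilbertBasis 𝕜 H
  have hs : Infinite s := not_finite_iff_infinite.1 fun _ => by
    have := Fintype.ofFinite s
    exact hH e.toOrthonormalBasis.toBasis.finiteDimensional_of_finite
  obtain ⟨k, hk⟩ := exists_injective_nat ι
  have ho : Orthonormal 𝕜 fun i => e (Infinite.natEmbedding s (k i)) :=
    e.orthonormal.comp _ ((Infinite.natEmbedding s).injective.comp hk)
  exact ⟨ho.orthogonalFamily.linearIsometry.comp b.repr.toLinearIsometry⟩

variable [CompleteSpace E]

theorem adjoint_isometry_apply (V : E →ₗᵢ[𝕜] H) (x : E) :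
    V.toContinuousLinearMap.adjoint (V x) = x :=
  DFunLike.congr_fun V.adjoint_comp_self x

/-- Conjugation `T ↦ V T V*` by an isometry `V`. -/
def conjIsometry (V : E →ₗᵢ[𝕜] H) : (E →L[𝕜] E) →⋆ₙₐ[𝕜] (H →L[𝕜] H) where
  toFun T := V.toContinuousLinearMap ∘L T ∘L V.toContinuousLinearMap.adjoint
  map_smul' r T := by ext; simp
  map_zero' := by ext; simp
  map_add' S T := by ext; simp
  map_mul' S T := by ext; simp [adjoint_isometry_apply]
  map_star' T := by
    simp [ContinuousLinearMap.star_eq_adjoint, ContinuousLinearMap.adjoint_comp,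
      ContinuousLinearMap.comp_assoc]

theorem conjIsometry_apply_map (V : E →ₗᵢ[𝕜] H) (T : E →L[𝕜] E) (x : E) :
    conjIsometry V T (V x) = V (T x) :=
  congrArg (V ∘ T) (adjoint_isometry_apply V x)

theorem lift_conjIsometry_apply_map {ι : Type*} (V : E →ₗᵢ[𝕜] H) (X : ι → E →L[𝕜] E)
    (α : FreeMonoid ι) (x : E) :
    FreeMonoid.lift (fun i => conjIsometry V (X i)) α (V x) = V (FreeMonoid.lift X α x) := by
  induction α using FreeMonoid.inductionOn' with
  | one => simp
  | of_mul i α ih => simp [ih, conjIsometry_apply_map]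

/-- Compression `T ↦ V* T V` by an isometry `V`. -/
def compress (V : E →ₗᵢ[𝕜] H) : (H →L[𝕜] H) →L[𝕜] (E →L[𝕜] E) :=
  V.toContinuousLinearMap.adjoint.postcomp E ∘L V.toContinuousLinearMap.precomp H

theorem compress_apply (V : E →ₗᵢ[𝕜] H) (T : H →L[𝕜] H) (x : E) :
    compress V T x = V.toContinuousLinearMap.adjoint (T (V x)) := rfl

theorem norm_compress_apply_le (V : E →ₗᵢ[𝕜] H) (T : H →L[𝕜] H) : ‖compress V T‖ ≤ ‖T‖ := by
  have hV := V.norm_toContinuousLinearMap_le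
  have hV' : ‖V.toContinuousLinearMap.adjoint‖ ≤ 1 := by rwa [LinearIsometryEquiv.norm_map]
  calc ‖compress V T‖
      ≤ ‖V.toContinuousLinearMap.adjoint‖ * (‖T‖ * ‖V.toContinuousLinearMap‖) :=
        (ContinuousLinearMap.opNorm_comp_le _ _).trans
          (mul_le_mul_of_nonneg_left (ContinuousLinearMap.opNorm_comp_le _ _) (norm_nonneg _))
    _ ≤ 1 * (‖T‖ * 1) := by gcongr
    _ = ‖T‖ := by ring

theorem compress_lift_conjIsometry {ι : Type*} (V : E →ₗᵢ[𝕜] H) (X : ι → E →L[𝕜] E)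
    (α : FreeMonoid ι) :
    compress V (FreeMonoid.lift (fun i => conjIsometry V (X i)) α) = FreeMonoid.lift X α := by
  ext x
  rw [compress_apply, lift_conjIsometry_apply_map, adjoint_isometry_apply]

end Isometry

section RowNorm

variable {n : ℕ} {E H : Type*} [NormedAddCommGroup E] [InnerProductSpace ℂ E] [CompleteSpace E]
  [NormedAddCommGroup H] [InnerProductSpace ℂ H] [CompleteSpace H]

theorem rowNorm_map_le (f : (E →L[ℂ] E) →⋆ₙₐ[ℂ] (H →L[ℂ] H)) (X : Fin n → E →L[ℂ] E) :
    rowNorm (fun i => f (X i)) ≤ rowNorm X := by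
  have hf : ∑ i, f (X i) * (f (X i)).adjoint = f (∑ i, X i * (X i).adjoint) := by
    simp only [map_sum, map_mul, ← ContinuousLinearMap.star_eq_adjoint, map_star]
  rw [rowNorm, hf]
  exact Real.sqrt_le_sqrt (NonUnitalStarAlgHom.norm_apply_le f _)

theorem rowNorm_smul (r : ℂ) (X : Fin n → E →L[ℂ] E) : rowNorm (r • X) = ‖r‖ * rowNorm X := by
  have hr : ∑ i, (r • X) i * ((r • X) i).adjoint = (r * star r) • ∑ i, X i * (X i).adjoint := by
    simp only [← ContinuousLinearMap.star_eq_adjoint, Pi.smul_apply, star_smul,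
      smul_mul_smul_comm, Finset.smul_sum]
  rw [rowNorm, hr, norm_smul, CStarRing.norm_self_mul_star, Real.sqrt_mul (by positivity),
    Real.sqrt_mul_self (norm_nonneg r), rowNorm]

theorem rowNorm_pos {X : Fin n → E →L[ℂ] E} {i : Fin n} (hX : X i ≠ 0) : 0 < rowNorm X := by
  refine Real.sqrt_pos.2 (norm_pos_iff.2 fun h => hX ?_)
  simp only [← ContinuousLinearMap.star_eq_adjoint] at h
  exact (CStarRing.mul_star_self_eq_zero_iff _).1 <|
    (Finset.sum_eq_zero_iff_of_nonneg fun j _ => mul_star_self_nonneg (X j)).1 h i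
      (Finset.mem_univ i)

theorem exists_tendsto_partialSum_norm_le (V : E →ₗᵢ[ℂ] H) {ρ : ℝ} {φ : Series n}
    (hφ : IsBoundedFreeHolomorphic H ρ φ) {X : Fin n → E →L[ℂ] E} (hX : X ∈ opBall n E ρ) :
    ∃ A : E →L[ℂ] E, Tendsto (partialSum φ fun α => FreeMonoid.lift X α) atTop (𝓝 A) ∧
      ‖A‖ ≤ sSup ((fun X => ‖evalOp φ X‖) '' opBall n H ρ) := by
  obtain ⟨hol, M, hM⟩ := hφ
  set Y : Fin n → H →L[ℂ] H := fun i => conjIsometry V (X i)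
  have hY : Y ∈ opBall n H ρ := (rowNorm_map_le (conjIsometry V) X).trans_lt hX
  have hlim := ((compress V).continuous.tendsto _).comp (tendsto_nhds_limUnder (hol Y hY))
  have hpow : (compress V ∘ partialSum φ fun α => FreeMonoid.lift Y α) =
      partialSum φ fun α => FreeMonoid.lift X α := by
    ext1 N
    simp only [Function.comp_apply, map_partialSum, Y, compress_lift_conjIsometry]
  have hbdd : BddAbove ((fun X => ‖evalOp φ X‖) '' opBall n H ρ) :=
    ⟨M, Set.forall_mem_image.2 hM⟩
  exact ⟨compress V (evalOp φ Y), hpow ▸ hlim, (norm_compress_apply_le V _).trans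
    (le_csSup hbdd (Set.mem_image_of_mem _ hY))⟩

end RowNorm

section FockSpace

variable {n : ℕ} (w : Weights n)

theorem Weights.ofReal_mon_ne_zero (α : Word n) : (w.mon α : ℂ) ≠ 0 :=
  Complex.ofReal_ne_zero.2 (w.mon_pos α).ne'

/-- The inclusion of the noncommutative polynomials into `F²(μ)` as a linear map. -/
def ofPolyₗ : NCPoly n →ₗ[ℂ] F2 w where
  toFun := ofPoly w
  map_add' p q := by ext α; simp [ofPoly]
  map_smul' r p := by ext α; simp [ofPoly]

theorem ofPolyₗ_apply (p : NCPoly n) : ofPolyₗ w p = ofPoly w p := rfl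

/-- The monomial `Z_α` as an element of `F²(μ)`. -/
def F2.Z (α : Word n) : F2 w := ofPoly w (MonoidAlgebra.single α 1)

theorem F2.series_Z (α : Word n) : (F2.Z w α).series = monomial α := by
  ext β
  simp [F2.Z, ofPoly, monomial, Finsupp.single_apply, Pi.single_apply, eq_comm]

theorem ofPoly_single (α : Word n) (r : ℂ) :
    ofPoly w (MonoidAlgebra.single α r) = r • F2.Z w α := by
  have h := (ofPolyₗ w).map_smul r (MonoidAlgebra.single α 1)
  rwa [MonoidAlgebra.smul_single, smul_eq_mul, mul_one] at h

variable {w}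

theorem F2.inner_Z (α : Word n) (f : F2 w) :
    inner ℂ (F2.Z w α) f = (w.mon α : ℂ) ^ 2 * f.series α := by
  rw [F2.inner_def, tsum_eq_single α]
  · simp [F2.series_Z, monomial]
  · intro β hβ
    simp [F2.series_Z, monomial, hβ]

theorem F2.ext_inner_Z {f g : F2 w}
    (h : ∀ α, inner ℂ (F2.Z w α) f = inner ℂ (F2.Z w α) g) : f = g := by
  ext α
  simpa only [F2.inner_Z, mul_eq_mul_left_iff, pow_eq_zero_iff two_ne_zero,
    w.ofReal_mon_ne_zero, or_false] using h α

variable (w)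

/-- The orthonormal basis `μ(α, g_0)⁻¹ Z_α` of `F²(μ)`. -/
def monomialBasis : HilbertBasis (Word n) ℂ (F2 w) := .ofRepr (toL2Isometry w)

theorem monomialBasis_repr_apply (f : F2 w) (α : Word n) :
    (monomialBasis w).repr f α = (w.mon α : ℂ) * f.series α := rfl

theorem monomialBasis_apply (α : Word n) :
    monomialBasis w α = (w.mon α : ℂ)⁻¹ • F2.Z w α := by
  refine (monomialBasis w).repr.injective (lp.ext (funext fun β => ?_))
  rw [HilbertBasis.repr_self, monomialBasis_repr_apply, F2.series_smul, F2.series_Z]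
  obtain rfl | hβ := eq_or_ne β α
  · simp [monomial, w.ofReal_mon_ne_zero]
  · simp [monomial, hβ]

variable {w}

theorem F2.hasSum_Z (f : F2 w) : HasSum (fun α => f.series α • F2.Z w α) f := by
  have h := (monomialBasis w).hasSum_repr f
  have hcoeff (α : Word n) : (w.mon α : ℂ) * f.series α * (w.mon α : ℂ)⁻¹ = f.series α := by
    rw [mul_right_comm, mul_inv_cancel₀ (w.ofReal_mon_ne_zero α), one_mul]
  simpa only [monomialBasis_repr_apply, monomialBasis_apply, smul_smul, hcoeff] using h

theorem F2.hasSum_apply_Z {E : Type*} [NormedAddCommGroup E] [NormedSpace ℂ E]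
    (A : F2 w →L[ℂ] E) (f : F2 w) : HasSum (fun α => f.series α • A (F2.Z w α)) (A f) := by
  simpa only [map_smul] using f.hasSum_Z.mapL A

theorem F2.clm_ext {E : Type*} [NormedAddCommGroup E] [NormedSpace ℂ E] {A B : F2 w →L[ℂ] E}
    (h : ∀ α, A (F2.Z w α) = B (F2.Z w α)) : A = B := by
  ext1 f
  have hB := F2.hasSum_apply_Z B f
  simp only [← h] at hB
  exact (F2.hasSum_apply_Z A f).unique hB

theorem denseRange_ofPoly : DenseRange (ofPoly w) := by
  refine dense_iff_closure_eq.2 (Set.eq_univ_of_forall fun f => ?_)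
  refine mem_closure_of_tendsto f.hasSum_Z (Eventually.of_forall fun s => ?_)
  refine ⟨∑ α ∈ s, MonoidAlgebra.single α (f.series α), ?_⟩
  exact (map_sum (ofPolyₗ w) _ s).trans (Finset.sum_congr rfl fun α _ => ofPoly_single w α _)

variable (w)

/-- The bounded functional `f ↦ c_α` on `F²(μ)`. -/
def F2.coeffL (α : Word n) : F2 w →L[ℂ] ℂ := ((w.mon α : ℂ) ^ 2)⁻¹ • innerSL ℂ (F2.Z w α)

@[simp] theorem F2.coeffL_apply (α : Word n) (f : F2 w) : F2.coeffL w α f = f.series α := by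
  simp [F2.coeffL, F2.inner_Z, w.ofReal_mon_ne_zero α]

variable {w}

theorem mon_sq_mul_norm_div_sq (a : ℂ) (α : Word n) :
    w.mon α ^ 2 * ‖a / (w.mon α : ℂ) ^ 2‖ ^ 2 = ‖a‖ ^ 2 / w.mon α ^ 2 := by
  have hmon := w.mon_pos α
  rw [norm_div, norm_pow, Complex.norm_of_nonneg hmon.le]
  field_simp

theorem F2.mon_sq_mul_norm_series_sq (f : F2 w) (α : Word n) :
    w.mon α ^ 2 * ‖f.series α‖ ^ 2 = ‖inner ℂ (F2.Z w α) f‖ ^ 2 / w.mon α ^ 2 := by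
  rw [← mon_sq_mul_norm_div_sq, F2.inner_Z,
    mul_div_cancel_left₀ _ (pow_ne_zero 2 (w.ofReal_mon_ne_zero α))]

theorem F2.norm_eq_sqrt_tsum_inner_Z (f : F2 w) :
    ‖f‖ = √(∑' α, ‖inner ℂ (F2.Z w α) f‖ ^ 2 / w.mon α ^ 2) := by
  simp only [← F2.mon_sq_mul_norm_series_sq, ← F2.norm_sq, Real.sqrt_sq (norm_nonneg f)]

theorem F2.exists_inner_Z_eq_iff {x : Word n → ℂ} :
    (∃ f : F2 w, ∀ α, inner ℂ (F2.Z w α) f = x α) ↔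
      Summable fun α => ‖x α‖ ^ 2 / w.mon α ^ 2 := by
  constructor
  · rintro ⟨f, hf⟩
    simpa only [F2.mon_sq_mul_norm_series_sq, hf] using f.summable
  · intro hx
    have hmem : (fun α => x α / (w.mon α : ℂ) ^ 2) ∈ hardySubmodule w := by
      simpa only [mem_hardySubmodule, mon_sq_mul_norm_div_sq] using hx
    refine ⟨F2.mk _ hmem, fun α => ?_⟩
    rw [F2.inner_Z, F2.series_mk, mul_div_cancel₀ _ (pow_ne_zero 2 (w.ofReal_mon_ne_zero α))]

theorem F2.exists_clm_apply_Z_eq_iff {x : Word n → ℂ} :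
    (∃ ℓ : F2 w →L[ℂ] ℂ, ∀ α, ℓ (F2.Z w α) = x α) ↔
      Summable fun α => ‖x α‖ ^ 2 / w.mon α ^ 2 := by
  have hconj := F2.exists_inner_Z_eq_iff (w := w) (x := fun α => starRingEnd ℂ (x α))
  simp only [RCLike.norm_conj] at hconj
  rw [← hconj, (InnerProductSpace.toDual ℂ (F2 w)).surjective.exists]
  simp only [InnerProductSpace.toDual_apply_apply, ← inner_conj_symm (F2.Z w _),
    (starRingEnd ℂ).injective.eq_iff]

theorem F2.norm_clm_eq_sqrt_tsum (ℓ : F2 w →L[ℂ] ℂ) :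
    ‖ℓ‖ = √(∑' α, ‖ℓ (F2.Z w α)‖ ^ 2 / w.mon α ^ 2) := by
  obtain ⟨y, rfl⟩ := (InnerProductSpace.toDual ℂ (F2 w)).surjective ℓ
  simp only [LinearIsometryEquiv.norm_map, InnerProductSpace.toDual_apply_apply,
    norm_inner_symm y, ← F2.norm_eq_sqrt_tsum_inner_Z]

end FockSpace

section PointEvaluations

variable {n : ℕ} {w : Weights n} {z : Fin n → ℂ}

theorem extendsEval_iff {ℓ : F2 w →L[ℂ] ℂ} :
    ExtendsEval w z ℓ ↔ ∀ α, ℓ (F2.Z w α) = FreeMonoid.lift z α := by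
  refine ⟨fun h α => (h _).trans (by simp [evalPoly]), fun h p => ?_⟩
  have hlin : ℓ.toLinearMap ∘ₗ ofPolyₗ w =
      (MonoidAlgebra.lift ℂ ℂ (Word n) (FreeMonoid.lift z)).toLinearMap :=
    MonoidAlgebra.lhom_ext' fun α => LinearMap.ext_ring ((h α).trans (by simp))
  exact LinearMap.congr_fun hlin p

theorem mem_boundedPointEvals_iff :
    z ∈ boundedPointEvals w ↔ ∃ ℓ : F2 w →L[ℂ] ℂ, ExtendsEval w z ℓ := by
  constructor
  · rintro ⟨C, -, hC⟩
    let ev := (MonoidAlgebra.lift ℂ ℂ (Word n) (FreeMonoid.lift z)).toLinearMap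
    exact ⟨ev.extendOfNorm (ofPolyₗ w), LinearMap.extendOfNorm_eq denseRange_ofPoly ⟨C, hC⟩⟩
  · rintro ⟨ℓ, hℓ⟩
    refine ⟨‖ℓ‖ + 1, by positivity, fun p => ?_⟩
    rw [← hℓ p]
    exact ℓ.le_of_opNorm_le (lt_add_one _).le _

theorem boundedPointEvals_eq :
    boundedPointEvals w =
      {z | Summable fun α : Word n => ‖FreeMonoid.lift z α‖ ^ 2 / w.mon α ^ 2} := by
  ext z
  simp only [mem_boundedPointEvals_iff, extendsEval_iff, F2.exists_clm_apply_Z_eq_iff,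
    Set.mem_ofPred_eq]

theorem ExtendsEval.hasSum {ℓ : F2 w →L[ℂ] ℂ} (hℓ : ExtendsEval w z ℓ) (f : F2 w) :
    HasSum (fun α => f.series α * FreeMonoid.lift z α) (ℓ f) := by
  simpa only [extendsEval_iff.1 hℓ, smul_eq_mul] using F2.hasSum_apply_Z ℓ f

theorem ExtendsEval.norm_apply_le {ℓ : F2 w →L[ℂ] ℂ} (hℓ : ExtendsEval w z ℓ) (f : F2 w) :
    ‖ℓ f‖ ≤ ‖f‖ * √(∑' α : Word n, ‖FreeMonoid.lift z α‖ ^ 2 / w.mon α ^ 2) := by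
  simp only [← extendsEval_iff.1 hℓ, ← F2.norm_clm_eq_sqrt_tsum]
  exact (ℓ.le_opNorm f).trans_eq (mul_comm _ _)

theorem ExtendsEval.extendsEval_iff_eq {ℓ ℓ' : F2 w →L[ℂ] ℂ} (hℓ : ExtendsEval w z ℓ) :
    ExtendsEval w z ℓ' ↔ ℓ' = ℓ := by
  refine ⟨fun hℓ' => F2.clm_ext fun α => ?_, fun h => h ▸ hℓ⟩
  rw [extendsEval_iff.1 hℓ, extendsEval_iff.1 hℓ']

theorem F2.exists_clm_apply_Z_of_tendsto_partialSum {x : Word n → ℂ}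
    (hx : ∀ f : F2 w, ∃ s : ℂ, Tendsto (partialSum f.series x) atTop (𝓝 s)) :
    ∃ ℓ : F2 w →L[ℂ] ℂ, ∀ α, ℓ (F2.Z w α) = x α := by
  choose s hs using hx
  have heval (N : ℕ) (f : F2 w) : partialSum x (F2.coeffL w) N f = partialSum f.series x N := by
    simp [partialSum, mul_comm]
  have hlim : Tendsto (fun N f => partialSum x (F2.coeffL w) N f) atTop (𝓝 s) :=
    tendsto_pi_nhds.2 fun f => by simpa only [heval] using hs f
  refine ⟨continuousLinearMapOfTendsto _ hlim, fun α => ?_⟩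
  refine tendsto_nhds_unique (hs (F2.Z w α)) (tendsto_const_nhds.congr' ?_)
  filter_upwards [eventually_gt_atTop α.length] with N hN
  rw [F2.series_Z, partialSum_eq_sum (s := {α})]
  · simp [monomial]
  · simpa using hN
  · intro β hβ
    simp [monomial, Finset.notMem_singleton.1 hβ]

end PointEvaluations

section Shift

variable {n : ℕ} {w : Weights n}

theorem series_lift_LZ_mul (α β : Word n) (f : F2 w) :
    (FreeMonoid.lift (LZ w) α f).series (α * β) = f.series β := by
  induction α using FreeMonoid.inductionOn' with
  | one => simp
  | of_mul i α ih =>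
    rw [map_mul, FreeMonoid.lift_eval_of, mul_apply_eq_comp, LZ_series, mul_assoc,
      mulSeries_gen_of_mul, if_pos rfl, ih]

theorem series_lift_LZ_of_notMem_range {α γ : Word n} (hγ : γ ∉ Set.range (α * ·)) (f : F2 w) :
    (FreeMonoid.lift (LZ w) α f).series γ = 0 := by
  induction α using FreeMonoid.inductionOn' generalizing γ with
  | one => exact absurd ⟨γ, one_mul γ⟩ hγ
  | of_mul i α ih =>
    rw [map_mul, FreeMonoid.lift_eval_of, mul_apply_eq_comp, LZ_series]
    cases γ using FreeMonoid.casesOn with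
    | one => exact mulSeries_gen_one i _
    | of_mul j γ =>
      rw [mulSeries_gen_of_mul]
      split_ifs with hji
      · subst hji
        refine ih ?_
        rintro ⟨β, rfl⟩
        exact hγ ⟨β, mul_assoc _ _ _⟩
      · rfl

theorem lift_LZ_Z (α β : Word n) : FreeMonoid.lift (LZ w) α (F2.Z w β) = F2.Z w (α * β) := by
  ext γ
  rw [F2.series_Z]
  by_cases hγ : γ ∈ Set.range (α * ·)
  · obtain ⟨δ, rfl⟩ := hγ
    simp [series_lift_LZ_mul, F2.series_Z, monomial, Pi.single_apply]
  · have hne : γ ≠ α * β := by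
      rintro rfl
      exact hγ ⟨β, rfl⟩
    rw [series_lift_LZ_of_notMem_range hγ, monomial, Pi.single_eq_of_ne hne]

theorem LZ_Z (i : Fin n) (β : Word n) : LZ w i (F2.Z w β) = F2.Z w (FreeMonoid.of i * β) := by
  rw [← lift_LZ_Z, FreeMonoid.lift_eval_of]

theorem rowNorm_LZ_pos (hn : 1 ≤ n) : 0 < rowNorm (LZ w) := by
  refine rowNorm_pos (i := ⟨0, hn⟩) fun h => ?_
  have hZ := congrArg (fun T : F2 w →L[ℂ] F2 w => (T (F2.Z w 1)).series (FreeMonoid.of ⟨0, hn⟩)) h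
  simp [LZ_Z, F2.series_Z, monomial] at hZ

theorem adjoint_LZ_apply_eq_smul_iff {z : Fin n → ℂ} {x : F2 w} :
    (∀ i, (LZ w i).adjoint x = z i • x) ↔
      ∀ α, inner ℂ (F2.Z w α) x = FreeMonoid.lift z α * inner ℂ (F2.Z w 1) x := by
  have hadj (i : Fin n) (α : Word n) :
      inner ℂ (F2.Z w α) ((LZ w i).adjoint x) = inner ℂ (F2.Z w (FreeMonoid.of i * α)) x := by
    rw [ContinuousLinearMap.adjoint_inner_right, LZ_Z]
  constructor
  · intro h α
    induction α using FreeMonoid.inductionOn' with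
    | one => simp
    | of_mul i α ih =>
      rw [← hadj, h i, inner_smul_right, ih, map_mul, FreeMonoid.lift_eval_of, mul_assoc]
  · refine fun h i => F2.ext_inner_Z fun α => ?_
    rw [hadj, inner_smul_right, h, h α, map_mul, FreeMonoid.lift_eval_of, mul_assoc]

theorem mem_jointPointSpectrum_adjoint_LZ_iff {z : Fin n → ℂ} :
    z ∈ jointPointSpectrum (fun i => (LZ w i).adjoint) ↔
      ∃ x : F2 w, ∀ α, inner ℂ (F2.Z w α) x = FreeMonoid.lift z α := by
  constructor
  · rintro ⟨x, hx, h⟩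
    have heig := adjoint_LZ_apply_eq_smul_iff.1 h
    have h1 : inner ℂ (F2.Z w 1) x ≠ 0 := fun h0 => hx <| F2.ext_inner_Z fun α => by
      rw [heig, h0, mul_zero, inner_zero_right]
    refine ⟨(inner ℂ (F2.Z w 1) x)⁻¹ • x, fun α => ?_⟩
    rw [inner_smul_right, heig α, mul_comm, mul_inv_cancel_right₀ h1]
  · rintro ⟨x, hx⟩
    have h1 : inner ℂ (F2.Z w 1) x = 1 := (hx 1).trans (map_one _)
    refine ⟨x, ?_, adjoint_LZ_apply_eq_smul_iff.2 fun α => by rw [hx, h1, mul_one]⟩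
    rintro rfl
    simp at h1

theorem jointPointSpectrum_adjoint_LZ :
    jointPointSpectrum (fun i => (LZ w i).adjoint) =
      {z | Summable fun α : Word n => ‖FreeMonoid.lift z α‖ ^ 2 / w.mon α ^ 2} := by
  ext z
  rw [mem_jointPointSpectrum_adjoint_LZ_iff, F2.exists_inner_Z_eq_iff, Set.mem_ofPred_eq]

end Shift

section Multipliers

variable {n : ℕ} {w : Weights n} {φ : Series n}

variable (w) in
/-- The operator `A` is the left multiplication `ζ ↦ φ ζ` by a formal power series. -/
def IsLeftMulOp (φ : Series n) (A : F2 w →L[ℂ] F2 w) : Prop :=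
  ∀ ζ : F2 w, (A ζ).series = mulSeries φ ζ.series

theorem IsLeftMulOp.isLeftMultiplier {L : F2 w →L[ℂ] F2 w} (hL : IsLeftMulOp w φ L) :
    IsLeftMultiplier w φ := fun ζ => hL ζ ▸ (L ζ).summable

theorem IsLeftMulOp.hasSum_lift_LZ_Z {L : F2 w →L[ℂ] F2 w} (hL : IsLeftMulOp w φ L)
    (β : Word n) : HasSum (fun α => φ α • FreeMonoid.lift (LZ w) α (F2.Z w β)) (L (F2.Z w β)) := by
  have hsum := (L (F2.Z w β)).hasSum_Z
  rw [hL, F2.series_Z, ← (mul_left_injective β).hasSum_iff fun γ hγ => by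
    rw [mulSeries_monomial_of_notMem_range φ hγ, zero_smul]] at hsum
  simpa only [Function.comp_def, mulSeries_monomial_mul, lift_LZ_Z] using hsum

theorem IsLeftMulOp.isSeriesOfShift {L : F2 w →L[ℂ] F2 w} (hL : IsLeftMulOp w φ L) :
    IsSeriesOfShift w φ L := by
  intro p
  simp only [← ofPolyₗ_apply]
  induction p using MonoidAlgebra.induction_linear with
  | zero => simp [hasSum_zero]
  | add p q hp hq => simpa only [map_add, smul_add] using hp.add hq
  | single β r =>
    simpa only [ofPolyₗ_apply, ofPoly_single, map_smul, smul_comm r] using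
      (hL.hasSum_lift_LZ_Z β).const_smul r

theorem IsLeftMulOp.isSeriesOfShift_iff {L A : F2 w →L[ℂ] F2 w} (hL : IsLeftMulOp w φ L) :
    IsSeriesOfShift w φ A ↔ A = L :=
  ⟨fun hA => F2.clm_ext fun _ => (hA _).unique (hL.isSeriesOfShift _),
    fun h => h ▸ hL.isSeriesOfShift⟩

/-- The bounded functional that sends an operator `T` to the coefficient of `T f` at `Z_γ`. -/
def opCoeffL (f : F2 w) (γ : Word n) : (F2 w →L[ℂ] F2 w) →L[ℂ] ℂ :=
  F2.coeffL w γ ∘L ContinuousLinearMap.apply ℂ (F2 w) f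

theorem opCoeffL_apply (f : F2 w) (γ : Word n) (T : F2 w →L[ℂ] F2 w) :
    opCoeffL f γ T = (T f).series γ :=
  F2.coeffL_apply w γ (T f)

theorem opCoeffL_partialSum_lift_LZ (φ : Series n) (f : F2 w) {γ : Word n} {N : ℕ}
    (hN : γ.length < N) :
    opCoeffL f γ (partialSum φ (fun α => FreeMonoid.lift (LZ w) α) N) =
      mulSeries φ f.series γ := by
  have hinj : Set.InjOn Prod.fst (splits γ : Set (Word n × Word n)) := fun p hp q hq hpq =>
    Prod.ext hpq (mul_left_cancel (a := p.1)
      ((mem_splits.1 hp).trans (hpq ▸ (mem_splits.1 hq).symm)))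
  rw [map_partialSum, partialSum_eq_sum (s := (splits γ).image Prod.fst),
    Finset.sum_image hinj, mulSeries]
  · refine Finset.sum_congr rfl fun p hp => ?_
    rw [opCoeffL_apply, ← mem_splits.1 hp, series_lift_LZ_mul, smul_eq_mul]
  · refine Finset.forall_mem_image.2 fun p hp => lt_of_le_of_lt ?_ hN
    rw [← mem_splits.1 hp, FreeMonoid.length_mul]
    exact Nat.le_add_right _ _
  · intro α hα
    have hγ : γ ∉ Set.range (α * ·) := by
      rintro ⟨β, hβ⟩
      exact hα (Finset.mem_image_of_mem Prod.fst (mem_splits (p := (α, β)) |>.2 hβ))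
    rw [opCoeffL_apply, series_lift_LZ_of_notMem_range hγ, smul_zero]

theorem isLeftMulOp_of_tendsto {A : F2 w →L[ℂ] F2 w}
    (hA : Tendsto (partialSum φ fun α => FreeMonoid.lift (LZ w) α) atTop (𝓝 A)) :
    IsLeftMulOp w φ A := by
  intro ζ
  ext γ
  have hγ := ((opCoeffL ζ γ).continuous.tendsto A).comp hA
  rw [← opCoeffL_apply]
  refine tendsto_nhds_unique hγ (tendsto_const_nhds.congr' ?_)
  filter_upwards [eventually_gt_atTop γ.length] with N hN
  exact (opCoeffL_partialSum_lift_LZ φ ζ hN).symm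

theorem F2.exists_norm_le_of_tendsto_series {ι : Type*} {l : Filter ι} [l.NeBot] {f : ι → F2 w}
    {c : Series n} {C : ℝ} (hf : ∀ i, ‖f i‖ ≤ C)
    (hc : Tendsto (fun i => (f i).series) l (𝓝 c)) : ∃ g : F2 w, g.series = c ∧ ‖g‖ ≤ C := by
  let x : lp (fun _ : Word n => ℂ) 2 := ⟨fun α => (w.mon α : ℂ) * c α, by
    refine lp.memℓp_of_tendsto (F := fun i => toL2 w (f i)) (l := l) ?_ ?_
    · refine isBounded_iff_forall_norm_le.2 ⟨C, Set.forall_mem_range.2 fun i => ?_⟩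
      rw [norm_toL2]
      exact hf i
    · exact tendsto_pi_nhds.2 fun α => (tendsto_pi_nhds.1 hc α).const_mul _⟩
  refine ⟨(toL2 w).symm x, ?_, ?_⟩
  · ext α
    exact inv_mul_cancel_left₀ (w.ofReal_mon_ne_zero α) (c α)
  · rw [← norm_toL2, LinearEquiv.apply_symm_apply]
    refine lp.norm_le_of_tendsto (F := fun i => toL2 w (f i)) (l := l)
      (Eventually.of_forall fun i => (norm_toL2 w (f i)).trans_le (hf i)) ?_
    exact tendsto_pi_nhds.2 fun α => (tendsto_pi_nhds.1 hc α).const_mul _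

theorem exists_isLeftMulOp_of_tendsto {ι : Type*} {l : Filter ι} [l.NeBot] {ψ : ι → Series n}
    {A : ι → F2 w →L[ℂ] F2 w} {M : ℝ} (hA : ∀ i, IsLeftMulOp w (ψ i) (A i))
    (hM : ∀ i, ‖A i‖ ≤ M) (hψ : Tendsto ψ l (𝓝 φ)) :
    ∃ L : F2 w →L[ℂ] F2 w, IsLeftMulOp w φ L ∧ ‖L‖ ≤ M := by
  have hmul (ζ : F2 w) : ∃ g : F2 w, g.series = mulSeries φ ζ.series ∧ ‖g‖ ≤ M * ‖ζ‖ := by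
    refine F2.exists_norm_le_of_tendsto_series (l := l) (f := fun i => A i ζ)
      (fun i => (A i).le_of_opNorm_le (hM i) ζ) ?_
    have hlim := ((continuous_mulSeries_left ζ.series).tendsto φ).comp hψ
    simpa only [hA _ ζ, Function.comp_def] using hlim
  choose T hT hnorm using hmul
  let Tₗ : F2 w →ₗ[ℂ] F2 w :=
    { toFun := T
      map_add' f g := F2.ext (by simp [hT, mulSeries_add])
      map_smul' r f := F2.ext (by simp [hT, mulSeries_smul]) }
  obtain ⟨i⟩ := l.nonempty_of_neBot
  exact ⟨Tₗ.mkContinuous M hnorm, hT,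
    Tₗ.mkContinuous_norm_le ((norm_nonneg _).trans (hM i)) hnorm⟩

theorem exists_isLeftMulOp_of_isBoundedFreeHolomorphic {H : Type*} [NormedAddCommGroup H]
    [InnerProductSpace ℂ H] [CompleteSpace H] (hn : 1 ≤ n) (hH : ¬ FiniteDimensional ℂ H)
    (hφ : IsBoundedFreeHolomorphic H (rowNorm (LZ w)) φ) :
    ∃ L : F2 w →L[ℂ] F2 w, IsLeftMulOp w φ L ∧
      ‖L‖ ≤ sSup ((fun X => ‖evalOp φ X‖) '' opBall n H (rowNorm (LZ w))) := by
  have : Countable (Word n) := inferInstanceAs (Countable (List (Fin n)))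
  obtain ⟨V⟩ := exists_linearIsometry_of_countable (monomialBasis w) hH
  have hdil (r : ℂ) (hr : ‖r‖ < 1) : ∃ A, IsLeftMulOp w (dilate r φ) A ∧
      ‖A‖ ≤ sSup ((fun X => ‖evalOp φ X‖) '' opBall n H (rowNorm (LZ w))) := by
    have hball : r • LZ w ∈ opBall n (F2 w) (rowNorm (LZ w)) :=
      (rowNorm_smul r (LZ w)).trans_lt (mul_lt_of_lt_one_left (rowNorm_LZ_pos hn) hr)
    obtain ⟨A, hA, hnorm⟩ := exists_tendsto_partialSum_norm_le V hφ hball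
    rw [partialSum_lift_smul] at hA
    exact ⟨A, isLeftMulOp_of_tendsto hA, hnorm⟩
  obtain ⟨u, -, hu, hlim⟩ := exists_seq_strictMono_tendsto' (zero_lt_one' ℝ)
  have hu1 (k : ℕ) : ‖(u k : ℂ)‖ < 1 := by
    rw [Complex.norm_of_nonneg (hu k).1.le]
    exact (hu k).2
  choose A hA hnorm using fun k => hdil (u k) (hu1 k)
  have hlim' : Tendsto (fun k => (u k : ℂ)) atTop (𝓝 1) :=
    (Complex.continuous_ofReal.tendsto 1).comp hlim
  exact exists_isLeftMulOp_of_tendsto hA hnorm ((tendsto_dilate φ).comp hlim')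

end Multipliers

end

end WeightedFock

theorem theorem4p2 (n : ℕ) (hn : 1 ≤ n) (w : Weights n) :
    (boundedPointEvals w =
        {z : Fin n → ℂ | Summable fun α : Word n => ‖FreeMonoid.lift z α‖ ^ 2 / w.mon α ^ 2} ∧
      {z : Fin n → ℂ | Summable fun α : Word n => ‖FreeMonoid.lift z α‖ ^ 2 / w.mon α ^ 2} =
        jointPointSpectrum fun i => ContinuousLinearMap.adjoint (LZ w i)) ∧
    (∀ z ∈ boundedPointEvals w, ∃ ℓ : F2 w →L[ℂ] ℂ,
      (∀ ℓ' : F2 w →L[ℂ] ℂ, ExtendsEval w z ℓ' ↔ ℓ' = ℓ) ∧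
      ∀ f : F2 w,
        (Summable fun α => ‖f.series α * FreeMonoid.lift z α‖) ∧
        HasSum (fun α => f.series α * FreeMonoid.lift z α) (ℓ f) ∧
        ‖∑' α, f.series α * FreeMonoid.lift z α‖ ≤
          ‖f‖ * √(∑' α : Word n, ‖FreeMonoid.lift z α‖ ^ 2 / w.mon α ^ 2)) ∧
    (∀ z : Fin n → ℂ,
      (∀ f : F2 w, ∃ s : ℂ,
        Tendsto (partialSum f.series fun α => FreeMonoid.lift z α) atTop (𝓝 s)) →
      z ∈ boundedPointEvals w) ∧
    (∀ (H : Type*) [NormedAddCommGroup H] [InnerProductSpace ℂ H] [CompleteSpace H],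
      ¬ FiniteDimensional ℂ H → ∀ φ : Series n, IsBoundedFreeHolomorphic H (rowNorm (LZ w)) φ →
        IsLeftMultiplier w φ ∧
        ∃ Lφ φL : F2 w →L[ℂ] F2 w,
          (∀ ζ : F2 w, (Lφ ζ).series = mulSeries φ ζ.series) ∧
          (∀ A : F2 w →L[ℂ] F2 w, IsSeriesOfShift w φ A ↔ A = φL) ∧
          ‖Lφ‖ = ‖φL‖ ∧
          ‖φL‖ ≤ sSup ((fun X => ‖evalOp φ X‖) '' opBall n H (rowNorm (LZ w)))) := by
  refine ⟨⟨boundedPointEvals_eq, jointPointSpectrum_adjoint_LZ.symm⟩, fun z hz => ?_,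
    fun z hz => ?_, fun H _ _ _ hH φ hφ => ?_⟩
  · obtain ⟨ℓ, hℓ⟩ := mem_boundedPointEvals_iff.1 hz
    refine ⟨ℓ, fun _ => hℓ.extendsEval_iff_eq, fun f => ⟨(hℓ.hasSum f).summable.norm,
      hℓ.hasSum f, ?_⟩⟩
    rw [(hℓ.hasSum f).tsum_eq]
    exact hℓ.norm_apply_le f
  · obtain ⟨ℓ, hℓ⟩ := F2.exists_clm_apply_Z_of_tendsto_partialSum hz
    exact mem_boundedPointEvals_iff.2 ⟨ℓ, extendsEval_iff.2 hℓ⟩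
  · obtain ⟨L, hL, hnorm⟩ := exists_isLeftMulOp_of_isBoundedFreeHolomorphic hn hH hφ
    exact ⟨hL.isLeftMultiplier, L, L, hL, fun _ => hL.isSeriesOfShift_iff, rfl, hnorm⟩
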